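/- Let $(x)_n=x(x+1)\cdots(x+n-1)$ (with $(x)_0=1$), and for complex parameters, with no $\beta_i$ equal to $0$ or a negative integer, let $$_pF_q\left[\begin{matrix}\alpha_1,\ldots,\alpha_p\\ \beta_1,\ldots,\beta_q\end{matrix};x\right]=\sum_{n=0}^{\infty}\frac{(\alpha_1)_n\cdots(\alpha_p)_n}{(\beta_1)_n\cdots(\beta_q)_n}\frac{x^n}{n!}.$$ **Theorem.** Let $s\ge 0$ be an integer and let $a,b_1,c_1,\ldots,b_{s+1},c_{s+1}$ be complex numbers such that none of $a/2$, $1+a-b_j$, $1+a-c_j$ ($1\le j\le s+1$) is zero or a negative integer. Then $$\begin{aligned} &{}_{2s+4}F_{2s+3}\left[\begin{matrix}a,\,1+\tfrac a2,\,b_1,\,c_1,\ldots,b_{s+1},\,c_{s+1}\\ \tfrac a2,\,1+a-b_1,\,1+a-c_1,\ldots,1+a-b_{s+1},\,1+a-c_{s+1}\end{matrix};\,-1\right]\\ &\quad=\frac{\Gamma(1+a-b_{s+1})\,\Gamma(1+a-c_{s+1})}{\Gamma(1+a)\,\Gamma(1+a-b_{s+1}-c_{s+1})}\\ &\qquad\times\sum_{k_1,\ldots,k_s\ge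 0}\ \prod_{j=1}^{s}\frac{(1+a-b_j-c_j)_{k_j}\,(b_{j+1})_{k_1+\cdots+k_j}\,(c_{j+1})_{k_1+\cdots+k_j}}{k_j!\,(1+a-b_j)_{k_1+\cdots+k_j}\,(1+a-c_j)_{k_1+\cdots+k_j}} \end{aligned}$$ whenever the series on the left converges (possibly only conditionally) and the multiple series on the right converges absolutely. Here $1/\Gamma$ is the entire function that vanishes at $0,-1,-2,\ldots$, and for $s=0$ the multiple sum is $1$. -/

import Mathlib

open Filter Topology

/-- The Pochhammer symbol `(x)_n = x (x + 1) ⋯ (x + n - 1)`. -/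
noncomputable def poch (x : ℂ) (n : ℕ) : ℂ :=
  (ascPochhammer ℂ n).eval x

theorem poch_eq_prod (x : ℂ) (n : ℕ) : poch x n = ∏ i ∈ Finset.range n, (x + i) := by
  induction n with
  | zero => simp [poch]
  | succ n ih =>
    rw [Finset.prod_range_succ, ← ih]
    simp [poch, ascPochhammer_succ_eval]

/-- The `n`-th term of the generalized hypergeometric series with upper parameters `as` and
lower parameters `bs` at the point `x`. -/
noncomputable def pFqTerm (as bs : List ℂ) (x : ℂ) (n : ℕ) : ℂ :=
  (as.map fun p => poch p n).prod / (bs.map fun q => poch q n).prod * (x ^ n / (n.factorial : ℂ))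

/-- The generalized hypergeometric series converges (possibly only conditionally) and has
the sum `L`: its partial sums tend to `L`. -/
def PFqHasSum (as bs : List ℂ) (x L : ℂ) : Prop :=
  Tendsto (fun N : ℕ => ∑ n ∈ Finset.range N, pFqTerm as bs x n) atTop (𝓝 L)

/-- The generalized hypergeometric series converges (possibly only conditionally). -/
def PFqConverges (as bs : List ℂ) (x : ℂ) : Prop :=
  ∃ L : ℂ, PFqHasSum as bs x L

/-- No lower parameter is zero or a negative integer. -/
def AdmissibleLower (bs : List ℂ) : Prop :=
  ∀ q ∈ bs, ∀ m : ℕ, q ≠ -(m : ℂ)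

/-- The upper parameters `a, 1 + a/2, b₁, c₁, …, b_{s+1}, c_{s+1}`; the parameters
`b_{j+1}, c_{j+1}` are `b j, c j`. -/
noncomputable def vwpUpper (s : ℕ) (a : ℂ) (b c : Fin (s + 1) → ℂ) : List ℂ :=
  a :: (1 + a / 2) :: (List.ofFn fun j => [b j, c j]).flatten

/-- The lower parameters `a/2, 1 + a - b₁, 1 + a - c₁, …, 1 + a - b_{s+1}, 1 + a - c_{s+1}`. -/
noncomputable def vwpLower (s : ℕ) (a : ℂ) (b c : Fin (s + 1) → ℂ) : List ℂ :=
  (a / 2) :: (List.ofFn fun j => [1 + a - b j, 1 + a - c j]).flatten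

theorem vwpUpper_length (s : ℕ) (a : ℂ) (b c : Fin (s + 1) → ℂ) :
    (vwpUpper s a b c).length = 2 * s + 4 := by
  simp [vwpUpper, List.length_flatten, List.map_ofFn, Function.comp_def, List.sum_ofFn]
  ring

theorem vwpLower_length (s : ℕ) (a : ℂ) (b c : Fin (s + 1) → ℂ) :
    (vwpLower s a b c).length = 2 * s + 3 := by
  simp [vwpLower, List.length_flatten, List.map_ofFn, Function.comp_def, List.sum_ofFn]
  ring

/-- The partial sum `k₁ + ⋯ + k_j` (the index `j` is shifted by one, as above). -/
def partialSum {s : ℕ} (k : Fin s → ℕ) (j : Fin s) : ℕ :=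
  ∑ i ∈ Finset.Iic j, k i

/-- The term of the `s`-fold multiple series at `k = (k₁, …, k_s)`: the product over
`j = 1, …, s` of
`(1+a-b_j-c_j)_{k_j} (b_{j+1})_{k₁+⋯+k_j} (c_{j+1})_{k₁+⋯+k_j}` divided by
`k_j! (1+a-b_j)_{k₁+⋯+k_j} (1+a-c_j)_{k₁+⋯+k_j}`. -/
noncomputable def multiTerm (s : ℕ) (a : ℂ) (b c : Fin (s + 1) → ℂ) (k : Fin s → ℕ) : ℂ :=
  ∏ j : Fin s,
    (poch (1 + a - b j.castSucc - c j.castSucc) (k j)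
        * poch (b j.succ) (partialSum k j) * poch (c j.succ) (partialSum k j))
      / (((k j).factorial : ℂ)
        * poch (1 + a - b j.castSucc) (partialSum k j)
        * poch (1 + a - c j.castSucc) (partialSum k j))

/-! The transformation comes from iterating Bailey's lemma in its `q → 1` form and then letting a
terminating identity pass to the limit, with care for conditional convergence.

Algebra. The Pfaff–Saalschütz sum gives Bailey's lemma (`IsBaileyPair.step`). Starting from the unit
pair, `s` steps build the multiple series on the `β` side, and one further step gives `∑ t_r w_N(r)
= G_N ∑ u_k (e)_{N-k}/(N-k)!` for each `N` (`sum_pFqTerm_mul_baileyWeight`). Here `t_r` are the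
terms on the left, `u_k` is the part of the multiple series of total degree `k`, `e =
1+a-b_{s+1}-c_{s+1}`, and `G_N` is `gammaFactor`.

Analysis. The weights `w_N(r)` tend to 1 with uniformly bounded variation, so the left side tends to
the sum of the series even if that converges only conditionally. The right side is a Cesàro sum of
order `e - 1`. If `re e > 0`, its limit must agree with the absolutely convergent sum
(`tsum_eq_of_tendsto_cesaro`). Otherwise absolute convergence forces the multiple series to have
finitely many nonzero terms (`re_pos_or_bounded_support`), and the limit is taken termwise.

If `1 + a` is zero or a negative integer, the denominators `(1+a)_n` vanish and the method breaks
down. Then `1/Γ(1+a) = 0`, and the left series terminates and is antisymmetric under reversal. -/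

/-! ### Pochhammer symbols -/

theorem poch_zero (x : ℂ) : poch x 0 = 1 := by simp [poch_eq_prod]

theorem poch_succ (x : ℂ) (n : ℕ) : poch x (n + 1) = poch x n * (x + n) := by
  simp [poch_eq_prod, Finset.prod_range_succ]

theorem poch_succ_left (x : ℂ) (n : ℕ) : poch x (n + 1) = x * poch (x + 1) n := by
  rw [poch_eq_prod, poch_eq_prod, Finset.prod_range_succ', mul_comm]
  congr 1
  · simp
  · refine Finset.prod_congr rfl fun i _ => ?_
    push_cast
    ring

theorem poch_add (x : ℂ) (m n : ℕ) : poch x (m + n) = poch x m * poch (x + m) n := by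
  induction n with
  | zero => simp [poch_zero]
  | succ n ih =>
    rw [← add_assoc, poch_succ, ih, poch_succ]
    push_cast
    ring

theorem add_natCast_ne_zero {x : ℂ} (h : ∀ m : ℕ, x ≠ -(m : ℂ)) (n : ℕ) : x + n ≠ 0 :=
  fun h0 => h n (eq_neg_of_add_eq_zero_left h0)

theorem poch_ne_zero {x : ℂ} (h : ∀ m : ℕ, x ≠ -(m : ℂ)) (n : ℕ) : poch x n ≠ 0 := by
  rw [poch_eq_prod]
  exact Finset.prod_ne_zero_iff.2 fun i _ => add_natCast_ne_zero h i

theorem poch_neg_natCast {m n : ℕ} (h : m < n) : poch (-(m : ℂ)) n = 0 := by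
  rw [poch_eq_prod]
  exact Finset.prod_eq_zero (Finset.mem_range.2 h) (by simp)

theorem poch_div_two_succ {a : ℂ} (h : ∀ m : ℕ, a / 2 ≠ -(m : ℂ)) (n : ℕ) :
    poch (1 + a / 2) n / poch (a / 2) n = (a + 2 * n) / a := by
  have ha : a ≠ 0 := fun h0 => h 0 (by simp [h0])
  have h1 := poch_succ_left (a / 2) n
  rw [poch_succ, add_comm (a / 2) 1] at h1
  rw [div_eq_div_iff (poch_ne_zero h n) ha]
  linear_combination (-2 : ℂ) * h1

/-! ### The Pfaff–Saalschütz summation -/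

/-- The Pfaff–Saalschütz summation in polynomial form. -/
theorem pfaff_saalschutz_polynomial (p q c : ℂ) (M : ℕ) :
    ∑ i ∈ Finset.range (M + 1), (M.choose i : ℂ) * poch p i * poch q i * poch (c - p - q) (M - i)
        * poch (c + i) (M - i) = poch (c - p) M * poch (c - q) M := by
  induction M with
  | zero => simp [poch_zero]
  | succ M ih =>
    -- This is `(c-p+M)(c-q+M) = (c-p-q+M-i)(c+M+i) + (p+i)(q+i)`: term `i` at level `M` feeds terms
    -- `i` and `i+1` at level `M+1`. The pieces recombine in `key` by Pascal's rule and `(i+1)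
    -- C(M,i+1) = (M-i) C(M,i)`.
    have split : ∀ i ∈ Finset.range (M + 1),
        (c - p + M) * (c - q + M) * ((M.choose i : ℂ) * poch p i * poch q i
          * poch (c - p - q) (M - i) * poch (c + i) (M - i))
        = (M.choose i : ℂ) * poch p i * poch q i
          * poch (c - p - q) (M + 1 - i) * poch (c + i) (M - i) * (c + M + i)
        + (M.choose i : ℂ) * poch p (i + 1) * poch q (i + 1)
          * poch (c - p - q) (M - i) * poch (c + i) (M - i) := by
      intro i hi
      have hi' : i ≤ M := Nat.lt_succ_iff.1 (Finset.mem_range.1 hi)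
      rw [Nat.succ_sub hi', poch_succ, poch_succ, poch_succ, Nat.cast_sub hi']
      ring
    rw [poch_succ, poch_succ, mul_mul_mul_comm, ← ih, mul_comm, Finset.mul_sum,
      Finset.sum_congr rfl split, Finset.sum_add_distrib, Finset.sum_range_succ',
      Finset.sum_range_succ _ M, Finset.sum_range_succ' _ M, Finset.sum_range_succ]
    have key : ∀ i ∈ Finset.range M,
        ((M + 1).choose (i + 1) : ℂ) * poch p (i + 1) * poch q (i + 1)
          * poch (c - p - q) (M + 1 - (i + 1)) * poch (c + ↑(i + 1)) (M + 1 - (i + 1))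
        = (M.choose (i + 1) : ℂ) * poch p (i + 1) * poch q (i + 1)
          * poch (c - p - q) (M + 1 - (i + 1)) * poch (c + ↑(i + 1)) (M - (i + 1))
            * (c + M + ↑(i + 1))
        + (M.choose i : ℂ) * poch p (i + 1) * poch q (i + 1)
          * poch (c - p - q) (M - i) * poch (c + i) (M - i) := by
      intro i hi
      have hi' : i + 1 ≤ M := Finset.mem_range.1 hi
      obtain ⟨d, rfl⟩ := Nat.exists_eq_add_of_le hi'
      have e1 : i + 1 + d + 1 - (i + 1) = d + 1 := by omega
      have e2 : i + 1 + d - (i + 1) = d := by omega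
      have e3 : i + 1 + d - i = d + 1 := by omega
      have hc : ((i + 1 + d).choose (i + 1) : ℂ) * (i + 1) = (i + 1 + d).choose i * (d + 1) := by
        have := Nat.choose_succ_right_eq (i + 1 + d) i
        rw [e3] at this
        exact_mod_cast this
      rw [e1, e2, e3, poch_succ_left (c + i) d, poch_succ (c + ↑(i + 1)) d, Nat.choose_succ_succ]
      have e4 : c + (i : ℂ) + 1 = c + ↑(i + 1) := by push_cast; ring
      rw [e4]
      push_cast
      linear_combination (-poch p (i + 1) * poch q (i + 1) * poch (c - p - q) (d + 1)
        * poch (c + (↑i + 1)) d) * hc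
    rw [Finset.sum_congr rfl key, Finset.sum_add_distrib]
    simp [poch_zero, poch_succ]
    ring

theorem natCast_factorial_ne_zero (n : ℕ) : (n.factorial : ℂ) ≠ 0 := by
  exact_mod_cast n.factorial_ne_zero

theorem pfaff_saalschutz (p q c : ℂ) (hc : ∀ m : ℕ, c ≠ -(m : ℂ)) (M : ℕ) :
    ∑ i ∈ Finset.range (M + 1), poch (c - p - q) (M - i) * poch p i * poch q i
        / ((M - i).factorial * i.factorial * poch c i)
      = poch (c - p) M * poch (c - q) M / (M.factorial * poch c M) := by
  rw [← pfaff_saalschutz_polynomial, Finset.sum_div]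
  refine Finset.sum_congr rfl fun i hi => ?_
  obtain ⟨d, rfl⟩ := Nat.exists_eq_add_of_le (Nat.lt_succ_iff.1 (Finset.mem_range.1 hi))
  rw [Nat.add_sub_cancel_left, poch_add c i d]
  have h1 : poch (c + i) d ≠ 0 := by
    have := poch_ne_zero hc (i + d)
    rw [poch_add] at this
    exact right_ne_zero_of_mul this
  have h2 := poch_ne_zero hc i
  have hf : ((i + d).choose i : ℂ) * (i.factorial * d.factorial) = (i + d).factorial := by
    have := Nat.add_choose_mul_factorial_mul_factorial i d
    rw [← Nat.choose_symm_add] at this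
    rw [← mul_assoc]
    exact_mod_cast this
  have := natCast_factorial_ne_zero i
  have := natCast_factorial_ne_zero d
  have := natCast_factorial_ne_zero (i + d)
  rw [div_eq_div_iff (by positivity) (by positivity), ← hf]
  ring

/-! ### Bailey pairs and Bailey's lemma -/

/-- `(α, β)` is a Bailey pair relative to `a` (in the limit `q → 1`). -/
def IsBaileyPair (a : ℂ) (α β : ℕ → ℂ) : Prop :=
  ∀ n, β n = ∑ r ∈ Finset.range (n + 1), α r / ((n - r).factorial * poch (1 + a) (n + r))

/-- The unit Bailey pair. -/
theorem isBaileyPair_unit {a : ℂ} (ha0 : a ≠ 0) (ha : ∀ m : ℕ, 1 + a ≠ -(m : ℂ)) :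
    IsBaileyPair a (fun r => (-1) ^ r * poch a r * (a + 2 * r) / (a * r.factorial))
      (fun n => if n = 0 then 1 else 0) := by
  intro n
  -- The partial sums have a closed form; at `R = n` it is cancelled by the one remaining term `r =
  -- n + 1`.
  have tele : ∀ n R : ℕ, R ≤ n → ∑ r ∈ Finset.range (R + 1),
      (-1) ^ r * poch a r * (a + 2 * r) / (a * r.factorial)
        / (((n + 1 - r).factorial : ℂ) * poch (1 + a) (n + 1 + r))
      = (-1) ^ R * poch a (R + 1) /
        (a * (n + 1) * R.factorial * (n - R).factorial * poch (1 + a) (n + 1 + R)) := by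
    intro n R hR
    have hn : (n : ℂ) + 1 ≠ 0 := by exact_mod_cast n.succ_ne_zero
    induction R with
    | zero =>
      have := poch_ne_zero ha (n + 1)
      have := natCast_factorial_ne_zero n
      simp [poch_zero, poch_succ, Nat.factorial_succ]
      field_simp
    | succ R ih =>
      rw [Finset.sum_range_succ, ih (by omega)]
      obtain ⟨d, rfl⟩ := Nat.exists_eq_add_of_le hR
      have e1 : R + 1 + d - R = d + 1 := by omega
      have e2 : R + 1 + d + 1 - (R + 1) = d + 1 := by omega
      have e3 : R + 1 + d - (R + 1) = d := by omega
      rw [e1, e2, e3, ← add_assoc, poch_succ (1 + a), poch_succ a (R + 1), Nat.factorial_succ,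
        Nat.factorial_succ]
      have h1 := poch_ne_zero ha (R + 1 + d + 1 + R)
      have h2 := add_natCast_ne_zero ha (R + 1 + d + 1 + R)
      have h3 := natCast_factorial_ne_zero R
      have h4 := natCast_factorial_ne_zero d
      have h5 : (R : ℂ) + 1 ≠ 0 := by exact_mod_cast R.succ_ne_zero
      have h6 : (d : ℂ) + 1 ≠ 0 := by exact_mod_cast d.succ_ne_zero
      push_cast at hn h2 ⊢
      field_simp
      ring
  cases n with
  | zero => simp [poch_zero, ha0]
  | succ n =>
    rw [Finset.sum_range_succ, tele n n le_rfl]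
    have h1 := poch_ne_zero ha (n + 1 + n)
    have h2 := add_natCast_ne_zero ha (n + 1 + n)
    have h3 := natCast_factorial_ne_zero n
    have hn : (n : ℂ) + 1 ≠ 0 := by exact_mod_cast n.succ_ne_zero
    rw [← add_assoc, poch_succ (1 + a)]
    simp only [Nat.factorial_succ, Nat.sub_self, Nat.factorial_zero, Nat.succ_ne_zero, if_false]
    push_cast at h2 ⊢
    field_simp
    ring

theorem sum_range_succ_comm_shift (F : ℕ → ℕ → ℂ) (N : ℕ) :
    ∑ k ∈ Finset.range (N + 1), ∑ r ∈ Finset.range (k + 1), F k r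
      = ∑ r ∈ Finset.range (N + 1), ∑ i ∈ Finset.range (N - r + 1), F (r + i) r := by
  simp only [Finset.range_eq_Ico]
  rw [← Finset.sum_Ico_Ico_comm 0 (N + 1) (fun r k => F k r)]
  refine Finset.sum_congr rfl fun r hr => ?_
  have hr' : r ≤ N := Nat.lt_succ_iff.1 (Finset.mem_Ico.1 hr).2
  rw [Finset.sum_Ico_eq_sum_range, ← Finset.range_eq_Ico, Nat.succ_sub hr']

/-- Bailey's lemma. -/
theorem IsBaileyPair.step {a : ℂ} {α β : ℕ → ℂ} (h : IsBaileyPair a α β) (p q : ℂ)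
    (ha : ∀ m : ℕ, 1 + a ≠ -(m : ℂ)) (hp : ∀ m : ℕ, 1 + a - p ≠ -(m : ℂ))
    (hq : ∀ m : ℕ, 1 + a - q ≠ -(m : ℂ)) :
    IsBaileyPair a
      (fun r => poch p r * poch q r / (poch (1 + a - p) r * poch (1 + a - q) r) * α r)
      (fun N => ∑ k ∈ Finset.range (N + 1), poch (1 + a - p - q) (N - k) * poch p k * poch q k
        / ((N - k).factorial * poch (1 + a - p) N * poch (1 + a - q) N) * β k) := by
  intro N
  simp only [h _, Finset.mul_sum]
  rw [sum_range_succ_comm_shift]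
  refine Finset.sum_congr rfl fun r hr => ?_
  obtain ⟨M, rfl⟩ := Nat.exists_eq_add_of_le (Nat.lt_succ_iff.1 (Finset.mem_range.1 hr))
  rw [Nat.add_sub_cancel_left]
  have hA : ∀ m : ℕ, 1 + a + ↑(r + r) ≠ -(m : ℂ) := by
    intro m hm
    apply ha (r + r + m)
    push_cast at hm ⊢
    linear_combination hm
  -- With `k = r + i`, the coefficient of `α r` is a Saalschützian sum over `i` whose parameters are
  -- `p`, `q` shifted by `r` and `1 + a` shifted by `2r`.
  have S := pfaff_saalschutz (p + r) (q + r) (1 + a + ↑(r + r)) hA M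
  have x1 : 1 + a + ↑(r + r) - (p + r) - (q + r) = 1 + a - p - q := by push_cast; ring
  have x2 : 1 + a + ↑(r + r) - (p + r) = 1 + a - p + r := by push_cast; ring
  have x3 : 1 + a + ↑(r + r) - (q + r) = 1 + a - q + r := by push_cast; ring
  rw [x1, x2, x3] at S
  have hP := poch_ne_zero hp (r + M)
  have hQ := poch_ne_zero hq (r + M)
  have hR := poch_ne_zero ha (r + r + M)
  have hrr := poch_ne_zero ha (r + r)
  rw [poch_add] at hP hQ hR
  have hM := natCast_factorial_ne_zero M
  calc _ = ∑ i ∈ Finset.range (M + 1), poch p r * poch q r * α r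
        / (poch (1 + a - p) (r + M) * poch (1 + a - q) (r + M) * poch (1 + a) (r + r))
        * (poch (1 + a - p - q) (M - i) * poch (p + r) i * poch (q + r) i
        / ((M - i).factorial * i.factorial * poch (1 + a + ↑(r + r)) i)) := by
        refine Finset.sum_congr rfl fun i hi => ?_
        rw [Nat.add_sub_add_left, Nat.add_sub_cancel_left, poch_add p, poch_add q,
          show r + i + r = r + r + i by ring, poch_add _ (r + r) i]
        simp only [div_eq_mul_inv, mul_inv]
        ring
    _ = _ := by
        rw [← Finset.mul_sum, S, show r + M + r = r + r + M by ring, poch_add _ (r + r) M,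
          poch_add _ r M, poch_add _ r M]
        have := left_ne_zero_of_mul hP
        have := right_ne_zero_of_mul hP
        have := left_ne_zero_of_mul hQ
        have := right_ne_zero_of_mul hQ
        have := right_ne_zero_of_mul hR
        field_simp

/-! ### The multiple series as an iterated Bailey chain -/

theorem sum_antidiagonalTuple_snoc (s n : ℕ) (f : (Fin (s + 1) → ℕ) → ℂ) :
    ∑ k ∈ Finset.Nat.antidiagonalTuple (s + 1) n, f k
      = ∑ m ∈ Finset.range (n + 1), ∑ k ∈ Finset.Nat.antidiagonalTuple s m,
          f (Fin.snoc k (n - m) : Fin (s + 1) → ℕ) := by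
  rw [Finset.sum_sigma']
  refine Finset.sum_bij' (fun k _ => ⟨∑ i, Fin.init k i, Fin.init k⟩)
    (fun x _ => (Fin.snoc x.2 (n - x.1) : Fin (s + 1) → ℕ)) ?_ ?_ ?_ ?_ ?_
  · intro k hk
    rw [Finset.Nat.mem_antidiagonalTuple, Fin.sum_univ_castSucc] at hk
    simp only [Finset.mem_sigma, Finset.mem_range, Finset.Nat.mem_antidiagonalTuple, and_true]
    simp only [Fin.init]
    omega
  · rintro ⟨m, k⟩ hx
    simp only [Finset.mem_sigma, Finset.mem_range, Finset.Nat.mem_antidiagonalTuple] at hx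
    simp only [Finset.Nat.mem_antidiagonalTuple, Fin.sum_snoc]
    omega
  · intro k hk
    rw [Finset.Nat.mem_antidiagonalTuple, Fin.sum_univ_castSucc] at hk
    have : n - ∑ i, Fin.init k i = k (Fin.last s) := by
      simp only [Fin.init]
      omega
    simp only [this, Fin.snoc_init_self]
  · rintro ⟨m, k⟩ hx
    simp only [Finset.mem_sigma, Finset.mem_range, Finset.Nat.mem_antidiagonalTuple] at hx
    simp only [Fin.init_snoc, hx.2]
  · intro k hk
    rw [Finset.Nat.mem_antidiagonalTuple, Fin.sum_univ_castSucc] at hk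
    have : n - ∑ i, Fin.init k i = k (Fin.last s) := by
      simp only [Fin.init]
      omega
    simp only [this, Fin.snoc_init_self]

theorem partialSum_snoc_castSucc {s : ℕ} (k : Fin s → ℕ) (m : ℕ) (j : Fin s) :
    partialSum (Fin.snoc k m : Fin (s + 1) → ℕ) j.castSucc = partialSum k j := by
  simp [partialSum, ← Fin.map_castSuccEmb_Iic]

theorem partialSum_snoc_last {s : ℕ} (k : Fin s → ℕ) (m : ℕ) :
    partialSum (Fin.snoc k m : Fin (s + 1) → ℕ) (Fin.last s) = ∑ i, k i + m := by
  rw [partialSum, ← Fin.top_eq_last, Finset.Iic_top, Fin.sum_snoc]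

theorem multiTerm_snoc (s : ℕ) (a : ℂ) (b c : Fin (s + 1 + 1) → ℂ) (k : Fin s → ℕ) (m : ℕ) :
    multiTerm (s + 1) a b c (Fin.snoc k m : Fin (s + 1) → ℕ)
      = multiTerm s a (fun j => b j.castSucc) (fun j => c j.castSucc) k
        * ((poch (1 + a - b (Fin.last s).castSucc - c (Fin.last s).castSucc) m
          * poch (b (Fin.last (s + 1))) (∑ i, k i + m)
          * poch (c (Fin.last (s + 1))) (∑ i, k i + m))
        / ((m.factorial : ℂ) * poch (1 + a - b (Fin.last s).castSucc) (∑ i, k i + m)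
          * poch (1 + a - c (Fin.last s).castSucc) (∑ i, k i + m))) := by
  rw [multiTerm, Fin.prod_univ_castSucc, multiTerm]
  simp only [partialSum_snoc_castSucc, partialSum_snoc_last, Fin.snoc_castSucc, Fin.snoc_last,
    Fin.succ_castSucc, Fin.succ_last]

/-- The part of the multiple series on which `k₁ + ⋯ + k_s = n`. -/
noncomputable def multiDiag (s : ℕ) (a : ℂ) (b c : Fin (s + 1) → ℂ) (n : ℕ) : ℂ :=
  ∑ k ∈ Finset.Nat.antidiagonalTuple s n, multiTerm s a b c k

/-- The last factor sees the first `s` indices only through their sum `m`. Grouping by `m` therefore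
produces the recursion for `β` in Bailey's lemma. -/
theorem multiDiag_succ (s : ℕ) (a : ℂ) (b c : Fin (s + 1 + 1) → ℂ) (n : ℕ) :
    multiDiag (s + 1) a b c n = ∑ m ∈ Finset.range (n + 1),
      multiDiag s a (fun j => b j.castSucc) (fun j => c j.castSucc) m
        * ((poch (1 + a - b (Fin.last s).castSucc - c (Fin.last s).castSucc) (n - m)
          * poch (b (Fin.last (s + 1))) n * poch (c (Fin.last (s + 1))) n)
        / (((n - m).factorial : ℂ) * poch (1 + a - b (Fin.last s).castSucc) n
          * poch (1 + a - c (Fin.last s).castSucc) n)) := by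
  rw [multiDiag, sum_antidiagonalTuple_snoc]
  refine Finset.sum_congr rfl fun m hm => ?_
  rw [multiDiag, Finset.sum_mul]
  refine Finset.sum_congr rfl fun k hk => ?_
  rw [Finset.Nat.mem_antidiagonalTuple] at hk
  have : m ≤ n := Nat.lt_succ_iff.1 (Finset.mem_range.1 hm)
  rw [multiTerm_snoc, hk, Nat.add_sub_cancel' this]

/-- The sequence `α` of the unit Bailey pair. -/
noncomputable def unitAlpha (a : ℂ) (r : ℕ) : ℂ :=
  (-1) ^ r * poch a r * (a + 2 * r) / (a * r.factorial)

/-- Each Bailey step consumes one pair `b_j, c_j` and adds one summation index. The last pair stays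
outside `β`, because it is spent in the final step that yields the terminating identity. -/
theorem exists_baileyPair_multiDiag {a : ℂ} (ha0 : a ≠ 0) (ha : ∀ m : ℕ, 1 + a ≠ -(m : ℂ))
    (s : ℕ) (b c : Fin (s + 1) → ℂ) (hb : ∀ j, ∀ m : ℕ, 1 + a - b j ≠ -(m : ℂ))
    (hc : ∀ j, ∀ m : ℕ, 1 + a - c j ≠ -(m : ℂ)) :
    ∃ β : ℕ → ℂ, IsBaileyPair a (fun r => (∏ j : Fin s, poch (b j.castSucc) r
        * poch (c j.castSucc) r / (poch (1 + a - b j.castSucc) r * poch (1 + a - c j.castSucc) r))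
          * unitAlpha a r) β
      ∧ ∀ n, multiDiag s a b c n = poch (b (Fin.last s)) n * poch (c (Fin.last s)) n * β n := by
  induction s with
  | zero =>
    refine ⟨fun n => if n = 0 then 1 else 0, ?_, ?_⟩
    · simpa [unitAlpha] using isBaileyPair_unit ha0 ha
    · intro n
      cases n with
      | zero => simp [multiDiag, multiTerm, poch_zero]
      | succ n => simp [multiDiag]
  | succ s ih =>
    obtain ⟨β, hβ, hu⟩ := ih (fun j => b j.castSucc) (fun j => c j.castSucc)
      (fun j => hb _) (fun j => hc _)
    have hst := hβ.step _ _ ha (hb (Fin.last s).castSucc) (hc (Fin.last s).castSucc)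
    refine ⟨fun N => ∑ k ∈ Finset.range (N + 1),
      poch (1 + a - b (Fin.last s).castSucc - c (Fin.last s).castSucc) (N - k)
        * poch (b (Fin.last s).castSucc) k * poch (c (Fin.last s).castSucc) k
        / ((N - k).factorial * poch (1 + a - b (Fin.last s).castSucc) N
          * poch (1 + a - c (Fin.last s).castSucc) N) * β k, ?_, fun n => ?_⟩
    · simp only [Fin.prod_univ_castSucc]
      convert hst using 2
      ring
    · rw [multiDiag_succ, Finset.mul_sum]
      refine Finset.sum_congr rfl fun m _ => ?_
      rw [hu]
      ring

/-! ### The terminating transformation -/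

/-- The parameters `1 + a/2` and `a/2` contribute `(a+2n)/a`, which together with `(a)_n (-1)^n /
n!` is the unit `α`; this is why the argument is `-1`. -/
theorem pFqTerm_vwp (s : ℕ) (a : ℂ) (b c : Fin (s + 1) → ℂ) (h : ∀ m : ℕ, a / 2 ≠ -(m : ℂ))
    (n : ℕ) :
    pFqTerm (vwpUpper s a b c) (vwpLower s a b c) (-1) n
      = (∏ j, poch (b j) n * poch (c j) n / (poch (1 + a - b j) n * poch (1 + a - c j) n))
        * unitAlpha a n := by
  have h1 := poch_div_two_succ h n
  have h2 : ∀ f g : Fin (s + 1) → ℂ, (((List.ofFn fun j => [f j, g j]).flatten).map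
      fun p => poch p n).prod = ∏ j, poch (f j) n * poch (g j) n := by
    intro f g
    simp [List.map_flatten, List.prod_flatten, List.map_ofFn, Function.comp_def, List.prod_ofFn,
      Fin.prod_univ_succ, mul_assoc]
  rw [pFqTerm, vwpUpper, vwpLower, List.map_cons, List.map_cons, List.map_cons, List.prod_cons,
    List.prod_cons, List.prod_cons, h2, h2, Finset.prod_div_distrib]
  calc _ = (poch (1 + a / 2) n / poch (a / 2) n)
        * ((∏ j, poch (b j) n * poch (c j) n)
          / ∏ j, poch (1 + a - b j) n * poch (1 + a - c j) n)
        * poch a n * ((-1) ^ n / (n.factorial : ℂ)) := by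
        simp only [div_eq_mul_inv, mul_inv]
        ring
    _ = _ := by
        rw [h1, unitAlpha]
        simp only [div_eq_mul_inv, mul_inv]
        ring

/-- The factor `N! (1+a)_N / ((N-r)! (1+a)_{N+r})`, extended by zero to `r > N`. -/
noncomputable def baileyWeight (a : ℂ) (N r : ℕ) : ℂ :=
  ∏ i ∈ Finset.range r, ((N : ℂ) - i) / (N + 1 + a + i)

theorem baileyWeight_eq {a : ℂ} (ha : ∀ m : ℕ, 1 + a ≠ -(m : ℂ)) {N r : ℕ} (h : r ≤ N) :
    baileyWeight a N r
      = N.factorial * poch (1 + a) N / ((N - r).factorial * poch (1 + a) (N + r)) := by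
  induction r with
  | zero =>
    have := natCast_factorial_ne_zero N
    have := poch_ne_zero ha N
    simp [baileyWeight]
    field_simp
  | succ r ih =>
    obtain ⟨d, rfl⟩ := Nat.exists_eq_add_of_le h
    rw [baileyWeight, Finset.prod_range_succ, ← baileyWeight, ih (by omega), ← add_assoc,
      poch_succ _ (r + 1 + d + r), show r + 1 + d - r = d + 1 by omega,
      show r + 1 + d - (r + 1) = d by omega, Nat.factorial_succ d]
    have h1 := poch_ne_zero ha (r + 1 + d + r)
    have h2 := add_natCast_ne_zero ha (r + 1 + d + r)
    have h3 := natCast_factorial_ne_zero d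
    have h4 : (d : ℂ) + 1 ≠ 0 := by exact_mod_cast d.succ_ne_zero
    push_cast at h2 ⊢
    have h5 : (r : ℂ) + 1 + d + 1 + a + r ≠ 0 := by
      convert h2 using 1
      ring
    rw [div_mul_div_comm, div_eq_div_iff (by positivity) (by positivity)]
    ring

/-- The terminating form of the transformation. -/
theorem sum_pFqTerm_mul_baileyWeight {a : ℂ} (ha2 : ∀ m : ℕ, a / 2 ≠ -(m : ℂ))
    (ha : ∀ m : ℕ, 1 + a ≠ -(m : ℂ))
    (s : ℕ) (b c : Fin (s + 1) → ℂ) (hb : ∀ j, ∀ m : ℕ, 1 + a - b j ≠ -(m : ℂ))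
    (hc : ∀ j, ∀ m : ℕ, 1 + a - c j ≠ -(m : ℂ)) (N : ℕ) :
    ∑ r ∈ Finset.range (N + 1),
        pFqTerm (vwpUpper s a b c) (vwpLower s a b c) (-1) r * baileyWeight a N r
      = N.factorial * poch (1 + a) N
          / (poch (1 + a - b (Fin.last s)) N * poch (1 + a - c (Fin.last s)) N)
        * ∑ k ∈ Finset.range (N + 1), multiDiag s a b c k
          * (poch (1 + a - b (Fin.last s) - c (Fin.last s)) (N - k) / (N - k).factorial) := by
  have ha0 : a ≠ 0 := fun h0 => ha2 0 (by simp [h0])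
  obtain ⟨β, hβ, hu⟩ := exists_baileyPair_multiDiag ha0 ha s b c hb hc
  have key := hβ.step _ _ ha (hb (Fin.last s)) (hc (Fin.last s)) N
  dsimp only at key
  calc _ = N.factorial * poch (1 + a) N * ∑ r ∈ Finset.range (N + 1),
        poch (b (Fin.last s)) r * poch (c (Fin.last s)) r /
          (poch (1 + a - b (Fin.last s)) r * poch (1 + a - c (Fin.last s)) r) *
        ((∏ j : Fin s, poch (b j.castSucc) r * poch (c j.castSucc) r /
            (poch (1 + a - b j.castSucc) r * poch (1 + a - c j.castSucc) r)) *
          unitAlpha a r) / (↑(N - r).factorial * poch (1 + a) (N + r)) := by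
        rw [Finset.mul_sum]
        refine Finset.sum_congr rfl fun r hr => ?_
        rw [pFqTerm_vwp s a b c ha2, baileyWeight_eq ha (Nat.lt_succ_iff.1 (Finset.mem_range.1 hr)),
          Fin.prod_univ_castSucc]
        ring
    _ = _ := by
        rw [← key, Finset.mul_sum, Finset.mul_sum]
        refine Finset.sum_congr rfl fun k _ => ?_
        rw [hu]
        simp only [div_eq_mul_inv, mul_inv]
        ring

/-! ### Limit of the left side: summability with weights of bounded variation -/

/-- Silverman–Toeplitz for null sequences: a fixed head vanishes termwise, and the tail is at most
`C` times a small bound on `x`. Dividing by `C + 1` avoids the case `C = 0`. -/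
theorem tendsto_toeplitz_zero {d : ℕ → ℕ → ℂ} {x : ℕ → ℂ} {C : ℝ}
    (hx : Tendsto x atTop (𝓝 0)) (hd : ∀ r, Tendsto (fun N => d N r) atTop (𝓝 0))
    (hC : ∀ᶠ N in atTop, ∑ r ∈ Finset.range (N + 1), ‖d N r‖ ≤ C) :
    Tendsto (fun N => ∑ r ∈ Finset.range (N + 1), d N r * x r) atTop (𝓝 0) := by
  have hC0 : 0 ≤ C := by
    obtain ⟨N, hN⟩ := hC.exists
    exact (Finset.sum_nonneg fun _ _ => norm_nonneg _).trans hN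
  rw [Metric.tendsto_atTop'] at hx
  rw [Metric.tendsto_nhds]
  intro ε hε
  obtain ⟨R, hR⟩ := hx (ε / (2 * (C + 1))) (by positivity)
  have hfin : Tendsto (fun N => ∑ r ∈ Finset.range (R + 1), d N r * x r) atTop (𝓝 0) := by
    have := tendsto_finsetSum (Finset.range (R + 1)) fun r _ => (hd r).mul_const (x r)
    simpa using this
  rw [Metric.tendsto_nhds] at hfin
  filter_upwards [hfin (ε / 2) (by positivity), hC, eventually_ge_atTop R] with N h1 h2 h3
  rw [dist_zero_right] at h1 ⊢
  rw [← Finset.sum_range_add_sum_Ico _ (Nat.succ_le_succ h3)]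
  have h4 : ‖∑ r ∈ Finset.Ico (R + 1) (N + 1), d N r * x r‖ ≤ C * (ε / (2 * (C + 1))) := by
    calc _ ≤ ∑ r ∈ Finset.Ico (R + 1) (N + 1), ‖d N r‖ * (ε / (2 * (C + 1))) := by
          refine norm_sum_le_of_le _ fun r hr => ?_
          rw [norm_mul]
          have := (hR r (Finset.mem_Ico.1 hr).1).le
          rw [dist_zero_right] at this
          gcongr
      _ ≤ _ := by
          rw [← Finset.sum_mul]
          gcongr
          refine le_trans (Finset.sum_le_sum_of_subset_of_nonneg ?_ fun _ _ _ => norm_nonneg _) h2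
          intro r hr
          simp only [Finset.mem_Ico, Finset.mem_range] at hr ⊢
          omega
  have h5 : C * (ε / (2 * (C + 1))) < ε / 2 := by
    rw [← mul_div_assoc, div_lt_div_iff₀ (by positivity) (by positivity)]
    nlinarith
  calc _ ≤ _ := norm_add_le _ _
    _ < ε / 2 + ε / 2 := by linarith
    _ = ε := by ring

/-- A regular summability method of bounded variation preserves the sum of a convergent series. -/
theorem tendsto_sum_mul_of_bounded_variation {t : ℕ → ℂ} {L : ℂ} {w : ℕ → ℕ → ℂ} {C : ℝ}
    (ht : Tendsto (fun N => ∑ n ∈ Finset.range N, t n) atTop (𝓝 L))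
    (h0 : ∀ N, w N 0 = 1) (hlast : ∀ N, w N (N + 1) = 0)
    (hw : ∀ r, Tendsto (fun N => w N r) atTop (𝓝 1))
    (hC : ∀ᶠ N in atTop, ∑ r ∈ Finset.range (N + 1), ‖w N r - w N (r + 1)‖ ≤ C) :
    Tendsto (fun N => ∑ r ∈ Finset.range (N + 1), t r * w N r) atTop (𝓝 L) := by
  -- Abel summation. At `n = N + 1` the boundary term vanishes and the differences of weights sum to
  -- 1, so `L` can be subtracted from every partial sum.
  have parts : ∀ N n, ∑ r ∈ Finset.range n, t r * w N r
      = (∑ r ∈ Finset.range n, t r) * w N n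
        + ∑ r ∈ Finset.range n, (w N r - w N (r + 1)) * ∑ i ∈ Finset.range (r + 1), t i := by
    intro N n
    induction n with
    | zero => simp
    | succ n ih =>
      rw [Finset.sum_range_succ, ih, Finset.sum_range_succ _ n, Finset.sum_range_succ _ n,
        Finset.sum_range_succ]
      ring
  have hx : Tendsto (fun r => ∑ i ∈ Finset.range (r + 1), t i - L) atTop (𝓝 0) := by
    simpa using ((tendsto_add_atTop_iff_nat 1).2 ht).sub_const L
  have := tendsto_toeplitz_zero (d := fun N r => w N r - w N (r + 1)) hx
    (fun r => by simpa using (hw r).sub (hw (r + 1))) hC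
  have h2 := this.add_const L
  rw [zero_add] at h2
  refine h2.congr fun N => ?_
  rw [parts, hlast, mul_zero, zero_add]
  simp only [mul_sub _ _ L, Finset.sum_sub_distrib, ← Finset.sum_mul]
  rw [← Finset.sum_sub_distrib, Finset.sum_range_sub', h0, hlast]
  ring

theorem tendsto_natCast_add_div_natCast_add (x y : ℂ) :
    Tendsto (fun N : ℕ => ((N : ℂ) + x) / (N + y)) atTop (𝓝 1) := by
  have h : ∀ z : ℂ, Tendsto (fun N : ℕ => 1 + z / (N : ℂ)) atTop (𝓝 1) := by
    intro z
    simpa using (tendsto_const_div_atTop_nhds_zero_nat z).const_add 1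
  have := (h x).div (h y) one_ne_zero
  rw [div_one] at this
  refine this.congr' ?_
  filter_upwards [eventually_gt_atTop 0] with N hN
  have hN' : (N : ℂ) ≠ 0 := by exact_mod_cast hN.ne'
  simp only [Pi.div_apply]
  rw [← mul_div_mul_left _ _ hN']
  congr 1 <;> field_simp

theorem tendsto_baileyWeight (a : ℂ) (r : ℕ) :
    Tendsto (fun N => baileyWeight a N r) atTop (𝓝 1) := by
  have := tendsto_finsetProd (Finset.range r) fun i _ =>
    tendsto_natCast_add_div_natCast_add (-(i : ℂ)) (1 + a + i)
  simp only [Finset.prod_const_one] at this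
  refine this.congr fun N => Finset.prod_congr rfl fun i _ => ?_
  congr 1
  ring

theorem baileyWeight_succ_self (a : ℂ) (N : ℕ) : baileyWeight a N (N + 1) = 0 :=
  Finset.prod_eq_zero (Finset.mem_range.2 N.lt_succ_self) (by simp)

/-- The weights are compared with the real product `v` obtained by replacing `1 + a` with its real
part. It dominates them in modulus, its differences telescope to 1, and each of its factors is at
most `1 + 2B/N`, so `v ≤ exp (2B)`. -/
theorem baileyWeight_bounded_variation (a : ℂ) :
    ∃ C : ℝ, ∀ᶠ N in atTop,
      ∑ r ∈ Finset.range (N + 1), ‖baileyWeight a N r - baileyWeight a N (r + 1)‖ ≤ C := by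
  set B : ℝ := ‖1 + a‖ with hB
  set A : ℝ := (1 + a).re with hA
  have hB0 : 0 ≤ B := norm_nonneg _
  have hAB : |A| ≤ B := Complex.abs_re_le_norm _
  have hAB' := abs_le.1 hAB
  -- The 1 is the telescoped `v`. The rest bounds `N + 1 ≤ 2N` errors, each at most `exp (2B) * 2B /
  -- (N/2)`.
  refine ⟨1 + 8 * B * Real.exp (2 * B), ?_⟩
  filter_upwards [eventually_ge_atTop (⌈2 * B⌉₊ + 1)] with N hN
  have hN1 : (1 : ℝ) ≤ N := by exact_mod_cast le_trans (Nat.le_add_left 1 _) hN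
  have hN2 : 2 * B ≤ N := (Nat.le_ceil _).trans (by exact_mod_cast le_trans (Nat.le_add_right _ 1) hN)
  have hden : ∀ i : ℕ, (N : ℝ) / 2 ≤ N + A + i := by
    intro i
    have : (0 : ℝ) ≤ i := i.cast_nonneg
    linarith
  have hpos : ∀ i : ℕ, (0 : ℝ) < N + A + i := fun i => lt_of_lt_of_le (by linarith) (hden i)
  have hnorm : ∀ i : ℕ, (N : ℝ) + A + i ≤ ‖(N : ℂ) + 1 + a + i‖ := by
    intro i
    refine le_trans (le_of_eq ?_) (Complex.re_le_norm _)
    simp [hA]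
    ring
  set v : ℕ → ℝ := fun r => ∏ i ∈ Finset.range r, ((N : ℝ) - i) / (N + A + i) with hv
  have hvsucc : ∀ r, v (r + 1) = v r * (((N : ℝ) - r) / (N + A + r)) := fun r => by
    simp only [hv, Finset.prod_range_succ]
  have hle : ∀ r ≤ N, ∀ i ∈ Finset.range r, (i : ℝ) ≤ N := by
    intro r hr i hi
    exact_mod_cast ((Finset.mem_range.1 hi).trans_le hr).le
  have hv0 : ∀ r ≤ N, 0 ≤ v r := fun r hr => Finset.prod_nonneg fun i hi =>
    div_nonneg (sub_nonneg.2 (hle r hr i hi)) (hpos i).le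
  have hwv : ∀ r ≤ N, ‖baileyWeight a N r‖ ≤ v r := by
    intro r hr
    rw [baileyWeight, norm_prod]
    refine Finset.prod_le_prod (fun _ _ => norm_nonneg _) fun i hi => ?_
    have h1 : ‖(N : ℂ) - i‖ = (N : ℝ) - i := by
      rw [← Complex.ofReal_natCast, ← Complex.ofReal_natCast, ← Complex.ofReal_sub,
        Complex.norm_real, Real.norm_of_nonneg (sub_nonneg.2 (hle r hr i hi))]
    rw [norm_div, h1]
    exact div_le_div_of_nonneg_left (sub_nonneg.2 (hle r hr i hi)) (hpos i) (hnorm i)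
  have hvV : ∀ r ≤ N, v r ≤ Real.exp (2 * B) := by
    intro r hr
    calc v r ≤ ∏ i ∈ Finset.range r, Real.exp (2 * B / N) := by
          refine Finset.prod_le_prod (fun i hi => div_nonneg (sub_nonneg.2 (hle r hr i hi))
            (hpos i).le) fun i hi => ?_
          have hi0 : (0 : ℝ) ≤ i := i.cast_nonneg
          refine le_trans ?_ (Real.add_one_le_exp _)
          rw [div_le_iff₀ (hpos i)]
          have h2 : (2 * B / N + 1) * (N + A + i) ≥ (2 * B / N + 1) * (N - B) := by
            gcongr
            linarith
          have h3 : (2 * B / N + 1) * (N - B) = N + B * (N - 2 * B) / N := by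
            field_simp
            ring
          have h4 : 0 ≤ B * (N - 2 * B) / N :=
            div_nonneg (mul_nonneg hB0 (by linarith)) (by linarith)
          linarith
      _ = Real.exp (r * (2 * B / N)) := by
          rw [Finset.prod_const, Finset.card_range, Real.exp_nat_mul]
      _ ≤ Real.exp (2 * B) := by
          apply Real.exp_le_exp.2
          have : (r : ℝ) ≤ N := by exact_mod_cast hr
          calc (r : ℝ) * (2 * B / N) ≤ N * (2 * B / N) := by gcongr
            _ = 2 * B := by field_simp
  have hdiff : ∀ r ∈ Finset.range (N + 1), ‖baileyWeight a N r - baileyWeight a N (r + 1)‖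
      ≤ (v r - v (r + 1)) + Real.exp (2 * B) * (2 * B) / (N / 2) := by
    intro r hr
    have hr' : r ≤ N := Nat.lt_succ_iff.1 (Finset.mem_range.1 hr)
    have hr0 : (0 : ℝ) ≤ r := r.cast_nonneg
    have hne : (N : ℂ) + 1 + a + r ≠ 0 := norm_pos_iff.1 ((hpos r).trans_le (hnorm r))
    have h1 : baileyWeight a N r - baileyWeight a N (r + 1)
        = baileyWeight a N r * ((2 * r + (1 + a)) / (N + 1 + a + r)) := by
      rw [baileyWeight, baileyWeight, Finset.prod_range_succ]
      field_simp
      ring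
    have h2 : v r - v (r + 1) = v r * ((2 * r + A) / (N + A + r)) := by
      have := (hpos r).ne'
      rw [hvsucc]
      field_simp
      ring
    have h3 : ‖(2 : ℂ) * r + (1 + a)‖ ≤ 2 * r + B := by
      refine (norm_add_le _ _).trans ?_
      simp [hB]
    rw [h1, norm_mul, norm_div, h2]
    calc _ ≤ v r * ((2 * r + B) / (N + A + r)) := by
          have := hwv r hr'
          have := hnorm r
          have := hpos r
          have := hv0 r hr'
          gcongr
      _ = v r * ((2 * r + A) / (N + A + r)) + v r * (B - A) / (N + A + r) := by
          ring
      _ ≤ _ := by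
          have := hvV r hr'
          have := hden r
          have : 0 ≤ B - A := by linarith
          have : B - A ≤ 2 * B := by linarith
          gcongr
  refine (Finset.sum_le_sum hdiff).trans ?_
  rw [Finset.sum_add_distrib, Finset.sum_range_sub', Finset.sum_const, Finset.card_range,
    nsmul_eq_mul]
  have hv_zero : v 0 = 1 := by simp [hv]
  have hv_last : v (N + 1) = 0 :=
    Finset.prod_eq_zero (Finset.mem_range.2 N.lt_succ_self) (by simp)
  rw [hv_zero, hv_last, sub_zero]
  refine add_le_add le_rfl ?_
  have hE := (Real.exp_pos (2 * B)).le
  push_cast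
  rw [mul_div_assoc', div_le_iff₀ (by linarith)]
  have : 0 ≤ B * Real.exp (2 * B) * (N - 1) := by
    apply mul_nonneg (mul_nonneg hB0 hE)
    linarith
  linarith

/-! ### Limit of the Gamma factor -/

/-- The reciprocal of Euler's limit for Gamma. At a pole `Complex.Gamma` has the value 0, and
`(x)_{n+1}` is eventually 0, so the formula persists. -/
theorem tendsto_poch_succ (x : ℂ) :
    Tendsto (fun n : ℕ => poch x (n + 1) / ((n : ℂ) ^ x * n.factorial)) atTop
      (𝓝 (Complex.Gamma x)⁻¹) := by
  by_cases hx : Complex.Gamma x = 0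
  · obtain ⟨m, rfl⟩ := (Complex.Gamma_eq_zero_iff x).1 hx
    rw [hx, inv_zero]
    refine tendsto_const_nhds.congr' ?_
    filter_upwards [eventually_ge_atTop m] with n hn
    rw [poch_neg_natCast (Nat.lt_succ_of_le hn), zero_div]
  · refine ((Complex.GammaSeq_tendsto_Gamma x).inv₀ hx).congr fun n => ?_
    rw [Complex.GammaSeq, inv_div, poch_eq_prod]

/-- The Gamma factor of the transformation at the finite level `N`. -/
noncomputable def gammaFactor (a p q : ℂ) (N : ℕ) : ℂ :=
  N.factorial * poch (1 + a) N / (poch (1 + a - p) N * poch (1 + a - q) N)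

theorem tendsto_gammaFactor_mul {a p q : ℂ} (hp : ∀ m : ℕ, 1 + a - p ≠ -(m : ℂ))
    (hq : ∀ m : ℕ, 1 + a - q ≠ -(m : ℂ)) :
    Tendsto (fun N => gammaFactor a p q N * (poch (1 + a - p - q) N / N.factorial)) atTop
      (𝓝 (Complex.Gamma (1 + a - p) * Complex.Gamma (1 + a - q)
        / (Complex.Gamma (1 + a) * Complex.Gamma (1 + a - p - q)))) := by
  rw [← tendsto_add_atTop_iff_nat 1]
  have hP := Complex.Gamma_ne_zero hp
  have hQ := Complex.Gamma_ne_zero hq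
  have := ((tendsto_poch_succ (1 + a)).mul (tendsto_poch_succ (1 + a - p - q))).div
    ((tendsto_poch_succ (1 + a - p)).mul (tendsto_poch_succ (1 + a - q)))
    (mul_ne_zero (inv_ne_zero hP) (inv_ne_zero hQ))
  have e : ∀ x y z w : ℂ, x⁻¹ * y⁻¹ / (z⁻¹ * w⁻¹) = z * w / (x * y) := by
    intro x y z w
    simp only [div_eq_mul_inv, mul_inv, inv_inv]
    ring
  rw [e] at this
  refine this.congr' ?_
  filter_upwards [eventually_gt_atTop 0] with n hn
  have hn' : (n : ℂ) ≠ 0 := by exact_mod_cast hn.ne'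
  have hf := natCast_factorial_ne_zero n
  have hf' := natCast_factorial_ne_zero (n + 1)
  -- The powers of `n` in the four Euler limits cancel because the exponents have equal sums.
  have hpow : (n : ℂ) ^ (1 + a) * (n : ℂ) ^ (1 + a - p - q)
      = (n : ℂ) ^ (1 + a - p) * (n : ℂ) ^ (1 + a - q) := by
    rw [← Complex.cpow_add _ _ hn', ← Complex.cpow_add _ _ hn']
    ring_nf
  have h1 : (n : ℂ) ^ (1 + a - p) ≠ 0 := by simp [Complex.cpow_eq_zero_iff, hn']
  have h2 : (n : ℂ) ^ (1 + a - q) ≠ 0 := by simp [Complex.cpow_eq_zero_iff, hn']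
  have h3 := poch_ne_zero hp (n + 1)
  have h4 := poch_ne_zero hq (n + 1)
  simp only [Pi.div_apply, gammaFactor]
  rw [div_mul_div_comm, div_mul_div_comm, mul_mul_mul_comm ((n : ℂ) ^ (1 + a)), hpow]
  field_simp

/-- The shift is moved onto `gammaFactor`, whose consecutive ratios tend to 1. Nothing is divided by
`(1+a-p-q)_N`, which may vanish. -/
theorem tendsto_gammaFactor_mul_shift {a p q : ℂ} (hp : ∀ m : ℕ, 1 + a - p ≠ -(m : ℂ))
    (hq : ∀ m : ℕ, 1 + a - q ≠ -(m : ℂ)) (k : ℕ) :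
    Tendsto (fun N => gammaFactor a p q N
        * (poch (1 + a - p - q) (N - k) / (N - k).factorial)) atTop
      (𝓝 (Complex.Gamma (1 + a - p) * Complex.Gamma (1 + a - q)
        / (Complex.Gamma (1 + a) * Complex.Gamma (1 + a - p - q)))) := by
  rw [← tendsto_add_atTop_iff_nat k]
  simp only [Nat.add_sub_cancel]
  induction k with
  | zero => exact tendsto_gammaFactor_mul hp hq
  | succ k ih =>
    have h1 : Tendsto (fun N : ℕ => (((N : ℂ) + (k + 1)) / (N + (1 + a - p + k)))
        * (((N : ℂ) + (1 + a + k)) / (N + (1 + a - q + k)))) atTop (𝓝 1) := by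
      simpa using (tendsto_natCast_add_div_natCast_add _ _).mul
        (tendsto_natCast_add_div_natCast_add _ _)
    have h2 := h1.mul ih
    rw [one_mul] at h2
    refine h2.congr fun N => ?_
    rw [← Nat.add_assoc N k 1, gammaFactor, gammaFactor, poch_succ, poch_succ, poch_succ,
      Nat.factorial_succ]
    push_cast
    have e1 : (N : ℂ) + (1 + a - p + k) = 1 + a - p + (N + k) := by ring
    have e2 : (N : ℂ) + (1 + a - q + k) = 1 + a - q + (N + k) := by ring
    rw [e1, e2]
    simp only [div_eq_mul_inv, mul_inv]
    ring

/-! ### Cesàro summation of complex order -/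

theorem poch_add_one_mul (e : ℂ) (n : ℕ) : e * poch (e + 1) n = poch e n * (e + n) := by
  rw [← poch_succ_left, poch_succ]

/-- The Cesàro number `(e)_n / n!`. -/
noncomputable def cesaroNum (e : ℂ) (n : ℕ) : ℂ := poch e n / n.factorial

theorem ne_neg_natCast_of_re_pos {e : ℂ} (he : 0 < e.re) (m : ℕ) : e ≠ -(m : ℂ) := by
  intro h
  rw [h] at he
  simp at he
  exact absurd he (not_lt.2 m.cast_nonneg)

theorem cesaroNum_ne_zero {e : ℂ} (he : 0 < e.re) (n : ℕ) : cesaroNum e n ≠ 0 :=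
  div_ne_zero (poch_ne_zero (ne_neg_natCast_of_re_pos he) n) (natCast_factorial_ne_zero n)

theorem cesaroNum_zero (e : ℂ) : cesaroNum e 0 = 1 := by simp [cesaroNum, poch_zero]

theorem cesaroNum_succ (e : ℂ) (n : ℕ) :
    cesaroNum e (n + 1) = cesaroNum e n * ((e + n) / (n + 1)) := by
  rw [cesaroNum, cesaroNum, poch_succ, Nat.factorial_succ]
  push_cast
  rw [div_mul_div_comm, mul_comm ((n : ℂ) + 1)]

/-- The Cesàro numbers are the coefficients of `(1-x)^(-e)`, and `(1-x) (1-x)^(-e-1) = (1-x)^(-e)`.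
-/
theorem cesaroNum_add_one_succ (e : ℂ) (n : ℕ) :
    cesaroNum (e + 1) (n + 1) = cesaroNum (e + 1) n + cesaroNum e (n + 1) := by
  have h := poch_add_one_mul e n
  have hn : (n : ℂ) + 1 ≠ 0 := by exact_mod_cast n.succ_ne_zero
  rw [cesaroNum, cesaroNum, cesaroNum, poch_succ e, ← h, poch_succ, Nat.factorial_succ]
  have := natCast_factorial_ne_zero n
  push_cast
  field_simp
  ring

theorem sum_cesaroNum (e : ℂ) (n : ℕ) :
    ∑ k ∈ Finset.range (n + 1), cesaroNum e k = cesaroNum (e + 1) n := by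
  induction n with
  | zero => simp [cesaroNum_zero]
  | succ n ih => rw [Finset.sum_range_succ, ih, cesaroNum_add_one_succ]

theorem norm_cesaroNum_add_one_growth (e : ℂ) (n : ℕ) :
    ‖cesaroNum (e + 1) n‖ * (1 + e.re / (n + 1)) ≤ ‖cesaroNum (e + 1) (n + 1)‖ := by
  rw [cesaroNum_succ, norm_mul]
  gcongr
  have hn : (0 : ℝ) < (n : ℝ) + 1 := by positivity
  have h1 : ‖(n : ℂ) + 1‖ = (n : ℝ) + 1 := by
    have : (n : ℂ) + 1 = ((n + 1 : ℕ) : ℂ) := by push_cast; rfl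
    rw [this, Complex.norm_natCast]
    push_cast
    rfl
  rw [norm_div, h1, le_div_iff₀ hn]
  refine le_trans (le_of_eq ?_) (Complex.re_le_norm _)
  simp
  field_simp
  ring

theorem monotone_norm_cesaroNum_add_one {e : ℂ} (he : 0 < e.re) :
    Monotone fun n => ‖cesaroNum (e + 1) n‖ := by
  refine monotone_nat_of_le_succ fun n => ?_
  refine le_trans ?_ (norm_cesaroNum_add_one_growth e n)
  have : 0 ≤ e.re / (n + 1) := by positivity
  exact le_mul_of_one_le_right (norm_nonneg _) (by linarith)

theorem tendsto_norm_cesaroNum_add_one {e : ℂ} (he : 0 < e.re) :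
    Tendsto (fun n => ‖cesaroNum (e + 1) n‖) atTop atTop := by
  have h : ∀ n, 1 + e.re * ∑ i ∈ Finset.range n, (1 / ((i : ℝ) + 1)) ≤ ‖cesaroNum (e + 1) n‖ := by
    intro n
    induction n with
    | zero => simp [cesaroNum_zero]
    | succ n ih =>
      have h1 : 1 ≤ ‖cesaroNum (e + 1) n‖ := by
        simpa [cesaroNum_zero] using monotone_norm_cesaroNum_add_one he (Nat.zero_le n)
      have h2 : 0 ≤ e.re / (n + 1) := by positivity
      have h3 := norm_cesaroNum_add_one_growth e n
      have h4 : e.re / (n + 1) ≤ ‖cesaroNum (e + 1) n‖ * (e.re / (n + 1)) :=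
        le_mul_of_one_le_left h2 h1
      rw [Finset.sum_range_succ, mul_add, mul_one_div]
      linarith
  refine tendsto_atTop_mono h ?_
  exact tendsto_atTop_add_const_left _ _
    (Real.tendsto_sum_range_one_div_nat_succ_atTop.const_mul_atTop he)

/-- For complex `e` the numbers need not be positive, so `sum_cesaroNum` does not control the sum of
moduli. Instead, `‖cesaroNum e (n+1)‖` is `‖e‖ / e.re` times a lower bound for the increment of
`‖cesaroNum (e+1) n‖`. -/
theorem sum_norm_cesaroNum_le {e : ℂ} (he : 0 < e.re) (n : ℕ) :
    ∑ k ∈ Finset.range (n + 1), ‖cesaroNum e k‖ ≤ ‖e‖ / e.re * ‖cesaroNum (e + 1) n‖ := by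
  have hne : e.re ≤ ‖e‖ := Complex.re_le_norm e
  induction n with
  | zero =>
    simp only [zero_add, Finset.sum_range_one, cesaroNum_zero, norm_one, mul_one]
    rwa [one_le_div he]
  | succ n ih =>
    rw [Finset.sum_range_succ]
    have h1 : cesaroNum e (n + 1) = cesaroNum (e + 1) n * (e / (n + 1)) := by
      have hn : (n : ℂ) + 1 ≠ 0 := by exact_mod_cast n.succ_ne_zero
      have h := cesaroNum_add_one_succ e n
      rw [cesaroNum_succ] at h
      have : cesaroNum e (n + 1)
          = cesaroNum (e + 1) n * ((e + 1 + n) / (n + 1)) - cesaroNum (e + 1) n := by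
        rw [h]
        ring
      rw [this]
      field_simp
      ring
    have h2 : ‖(n : ℂ) + 1‖ = (n : ℝ) + 1 := by
      have : (n : ℂ) + 1 = ((n + 1 : ℕ) : ℂ) := by push_cast; rfl
      rw [this, Complex.norm_natCast]
      push_cast
      rfl
    have h3 := norm_cesaroNum_add_one_growth e n
    have h4 : ‖cesaroNum e (n + 1)‖
        = ‖e‖ / e.re * (‖cesaroNum (e + 1) n‖ * (e.re / (n + 1))) := by
      rw [h1, norm_mul, norm_div, h2]
      field_simp
    have h5 : 0 ≤ ‖e‖ / e.re := by positivity
    calc _ ≤ ‖e‖ / e.re * ‖cesaroNum (e + 1) n‖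
        + ‖e‖ / e.re * (‖cesaroNum (e + 1) n‖ * (e.re / (n + 1))) := by
          rw [h4]
          gcongr
      _ = ‖e‖ / e.re * (‖cesaroNum (e + 1) n‖ * (1 + e.re / (n + 1))) := by ring
      _ ≤ _ := by gcongr

theorem tendsto_cesaroNum_sub_div {e : ℂ} (he : 0 < e.re) (k : ℕ) :
    Tendsto (fun N => cesaroNum e (N - k) / cesaroNum e N) atTop (𝓝 1) := by
  rw [← tendsto_add_atTop_iff_nat k]
  simp only [Nat.add_sub_cancel]
  induction k with
  | zero => simp [div_self (cesaroNum_ne_zero he _)]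
  | succ k ih =>
    have := ih.mul (tendsto_natCast_add_div_natCast_add (k + 1) (e + k))
    rw [one_mul] at this
    refine this.congr fun N => ?_
    rw [← Nat.add_assoc N k 1, cesaroNum_succ, div_mul_div_comm, mul_div_assoc']
    have h1 : ((N + k : ℕ) : ℂ) + 1 ≠ 0 := by exact_mod_cast (N + k).succ_ne_zero
    have h2 := cesaroNum_ne_zero he (N + k)
    have h3 : e + ((N + k : ℕ) : ℂ) ≠ 0 := add_natCast_ne_zero (ne_neg_natCast_of_re_pos he) _
    have h4 : (N : ℂ) + (e + k) = e + ((N + k : ℕ) : ℂ) := by push_cast; ring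
    have h5 : (N : ℂ) + (k + 1) = ((N + k : ℕ) : ℂ) + 1 := by push_cast; ring
    rw [h4, h5]
    field_simp

/-- Consistency of Cesàro summation of order `e - 1`, `re e > 0`, with absolute convergence. -/
theorem tsum_eq_of_tendsto_cesaro {e : ℂ} (he : 0 < e.re) {u : ℕ → ℂ} (hu : Summable u) {l : ℂ}
    (h : Tendsto (fun N => (∑ k ∈ Finset.range (N + 1), u k * cesaroNum e (N - k))
      / cesaroNum e N) atTop (𝓝 l)) : ∑' k, u k = l := by
  set T : ℕ → ℂ := fun N => ∑ k ∈ Finset.range (N + 1), u k * cesaroNum e (N - k) with hT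
  have hsumT : ∀ N, ∑ n ∈ Finset.range (N + 1), T n
      = ∑ k ∈ Finset.range (N + 1), u k * cesaroNum (e + 1) (N - k) := by
    intro N
    simp only [hT]
    rw [sum_range_succ_comm_shift]
    refine Finset.sum_congr rfl fun r _ => ?_
    simp only [Nat.add_sub_cancel_left]
    rw [← Finset.mul_sum, sum_cesaroNum]
  have he1 : 0 < (e + 1).re := by
    simp
    linarith
  have hA := fun n => cesaroNum_ne_zero he1 n
  -- Summing `T` raises the order by one. There the weights have modulus at most 1 by monotonicity,
  -- so dominated convergence applies; at order `e` itself they can be unbounded when `re e < 1`.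
  have lim1 : Tendsto (fun N => (∑ n ∈ Finset.range (N + 1), T n) / cesaroNum (e + 1) N) atTop
      (𝓝 (∑' k, u k)) := by
    have := tendsto_tsum_of_dominated_convergence (𝓕 := (atTop : Filter ℕ))
      (f := fun N k => if k ∈ Finset.range (N + 1) then
        u k * (cesaroNum (e + 1) (N - k) / cesaroNum (e + 1) N) else 0)
      (g := u) hu.norm ?_ ?_
    · refine this.congr fun N => ?_
      rw [hsumT, Finset.sum_div, tsum_eq_sum (s := Finset.range (N + 1))]
      · refine Finset.sum_congr rfl fun k hk => ?_
        rw [if_pos hk, mul_div_assoc]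
      · intro k hk
        rw [if_neg hk]
    · intro k
      have := (tendsto_cesaroNum_sub_div he1 k).const_mul (u k)
      rw [mul_one] at this
      refine this.congr' ?_
      filter_upwards [eventually_ge_atTop k] with N hN
      rw [if_pos (Finset.mem_range.2 (Nat.lt_succ_of_le hN))]
    · refine Eventually.of_forall fun N k => ?_
      split_ifs
      · rw [norm_mul, norm_div]
        refine mul_le_of_le_one_right (norm_nonneg _) ?_
        exact div_le_one_of_le₀ (monotone_norm_cesaroNum_add_one he (Nat.sub_le N k))
          (norm_nonneg _)
      · simp
  -- Raising the order preserves the limit: `T n = l * cesaroNum e n + o(‖cesaroNum e n‖)` is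
  -- summed, the moduli having a divergent sum that is `O(cesaroNum (e+1))`.
  have lim2 : Tendsto (fun N => (∑ n ∈ Finset.range (N + 1), T n) / cesaroNum (e + 1) N) atTop
      (𝓝 l) := by
    have ho : (fun n => T n - l * cesaroNum e n) =o[atTop] fun n => ‖cesaroNum e n‖ := by
      rw [Asymptotics.isLittleO_norm_right, Asymptotics.isLittleO_iff_tendsto'
        (Eventually.of_forall fun n h0 => absurd h0 (cesaroNum_ne_zero he n))]
      have := h.sub_const l
      rw [sub_self] at this
      refine this.congr fun n => ?_
      rw [sub_div, mul_div_assoc, div_self (cesaroNum_ne_zero he n), mul_one]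
    have hinf : Tendsto (fun n => ∑ i ∈ Finset.range n, ‖cesaroNum e i‖) atTop atTop := by
      rw [← tendsto_add_atTop_iff_nat 1]
      refine tendsto_atTop_mono (fun n => ?_) (tendsto_norm_cesaroNum_add_one he)
      rw [← sum_cesaroNum]
      exact norm_sum_le _ _
    have ho2 := (ho.sum_range (fun n => norm_nonneg _) hinf).comp_tendsto (tendsto_add_atTop_nat 1)
    have hO : ((fun n => ∑ i ∈ Finset.range n, ‖cesaroNum e i‖) ∘ fun n => n + 1)
        =O[atTop] fun n => cesaroNum (e + 1) n := by
      refine Asymptotics.IsBigO.of_bound (‖e‖ / e.re) (Eventually.of_forall fun n => ?_)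
      rw [Function.comp, Real.norm_of_nonneg (Finset.sum_nonneg fun _ _ => norm_nonneg _)]
      exact sum_norm_cesaroNum_le he n
    have := (ho2.trans_isBigO hO).tendsto_div_nhds_zero.add_const l
    rw [zero_add] at this
    refine this.congr fun N => ?_
    have hN := hA N
    simp only [Function.comp, Finset.sum_sub_distrib, ← Finset.mul_sum, sum_cesaroNum]
    field_simp
    ring
  exact tendsto_nhds_unique lim1 lim2

/-! ### What absolute convergence of the multiple series forces -/

theorem poch_one (n : ℕ) : poch 1 n = n.factorial := by
  induction n with
  | zero => simp [poch_zero]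
  | succ n ih =>
    rw [poch_succ, ih, Nat.factorial_succ]
    push_cast
    ring

theorem isTheta_poch_succ {x : ℂ} (hx : ∀ m : ℕ, x ≠ -(m : ℂ)) :
    (fun n : ℕ => poch x (n + 1)) =Θ[atTop] fun n : ℕ => (n : ℝ) ^ x.re * (n.factorial : ℝ) := by
  have h1 := (Asymptotics.isTheta_of_div_tendsto_nhds_ne_zero (tendsto_poch_succ x)
    (inv_ne_zero (Complex.Gamma_ne_zero hx))).symm
  have h2 : (fun n : ℕ => (n : ℂ) ^ x * (n.factorial : ℂ)) =Θ[atTop]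
      fun n : ℕ => (n : ℝ) ^ x.re * (n.factorial : ℝ) := by
    refine Asymptotics.IsTheta.of_norm_eventuallyEq_norm ?_
    filter_upwards [eventually_gt_atTop 0] with n hn
    rw [norm_mul, norm_mul, Complex.norm_natCast_cpow_of_pos hn, Real.norm_of_nonneg (by positivity),
      Complex.norm_natCast, Real.norm_natCast]
  exact h1.trans h2

theorem isTheta_poch_div {x y : ℂ} (hx : ∀ m : ℕ, x ≠ -(m : ℂ)) (hy : ∀ m : ℕ, y ≠ -(m : ℂ)) :
    (fun n : ℕ => poch x (n + 1) / poch y (n + 1)) =Θ[atTop]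
      fun n : ℕ => (n : ℝ) ^ (x.re - y.re) := by
  refine ((isTheta_poch_succ hx).div (isTheta_poch_succ hy)).trans_eventuallyEq ?_
  filter_upwards [eventually_gt_atTop 0] with n hn
  have h1 : (n.factorial : ℝ) ≠ 0 := by exact_mod_cast n.factorial_ne_zero
  rw [mul_div_mul_right _ _ h1, Real.rpow_sub (by exact_mod_cast hn)]

theorem isTheta_rpow_mul {f g : ℕ → ℂ} {p q : ℝ}
    (hf : f =Θ[atTop] fun n : ℕ => (n : ℝ) ^ p) (hg : g =Θ[atTop] fun n : ℕ => (n : ℝ) ^ q) :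
    (fun n => f n * g n) =Θ[atTop] fun n : ℕ => (n : ℝ) ^ (p + q) := by
  refine (hf.mul hg).trans_eventuallyEq ?_
  filter_upwards [eventually_gt_atTop 0] with n hn
  rw [Real.rpow_add (by exact_mod_cast hn)]

theorem partialSum_single {s : ℕ} (j : Fin s) (n : ℕ) (i : Fin s) :
    partialSum (Pi.single j n) i = if j ≤ i then n else 0 := by
  simp [partialSum, Finset.sum_pi_single']

theorem multiTerm_ne_zero {s : ℕ} {a : ℂ} {b c : Fin (s + 1) → ℂ} {k : Fin s → ℕ}
    (h : multiTerm s a b c k ≠ 0) (i : Fin s) :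
    poch (1 + a - b i.castSucc - c i.castSucc) (k i) ≠ 0 ∧ poch (b i.succ) (partialSum k i) ≠ 0
      ∧ poch (c i.succ) (partialSum k i) ≠ 0 := by
  have := Finset.prod_ne_zero_iff.1 h i (Finset.mem_univ i)
  rw [div_ne_zero_iff, mul_ne_zero_iff, mul_ne_zero_iff] at this
  exact ⟨this.1.1.1, this.1.1.2, this.1.2⟩

/-- Along the axis where only `k_j` is nonzero, the terms have exact order `n` to a power that is at
least `-1`. -/
theorem not_summable_multiTerm {s : ℕ} {a : ℂ} {b c : Fin (s + 1) → ℂ}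
    (hB : ∀ j, ∀ m : ℕ, 1 + a - b j ≠ -(m : ℂ)) (hC : ∀ j, ∀ m : ℕ, 1 + a - c j ≠ -(m : ℂ))
    (j : Fin s) (he : ∀ m : ℕ, 1 + a - b j.castSucc - c j.castSucc ≠ -(m : ℂ))
    (hb : ∀ i : Fin s, j ≤ i → ∀ m : ℕ, b i.succ ≠ -(m : ℂ))
    (hc : ∀ i : Fin s, j ≤ i → ∀ m : ℕ, c i.succ ≠ -(m : ℂ))
    (hre : ∀ l : Fin (s + 1), j.castSucc < l → (1 + a - b l - c l).re ≤ 0) :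
    ¬ Summable (multiTerm s a b c) := by
  intro hs
  set r : Fin (s + 1) → ℝ := fun l => (1 + a - b l - c l).re with hr
  -- `E i` is the order of growth of factor `i`: a constant before `j`, a ratio of Pochhammer
  -- symbols after `j`, and at `j` that ratio times `(1+a-b_j-c_j)_n / n!`, of order `r_j - 1`.
  set E : Fin s → ℝ := fun i =>
    if j < i then -(r i.succ + r i.castSucc) else if j = i then -1 - r i.succ else 0 with hE
  have hone : ∀ m : ℕ, (1 : ℂ) ≠ -(m : ℂ) := ne_neg_natCast_of_re_pos (by simp)
  have hratio : ∀ i : Fin s, j ≤ i → (fun n : ℕ =>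
      poch (b i.succ) (n + 1) / poch (1 + a - b i.castSucc) (n + 1)
        * (poch (c i.succ) (n + 1) / poch (1 + a - c i.castSucc) (n + 1)))
      =Θ[atTop] fun n : ℕ => (n : ℝ) ^ (-(r i.succ + r i.castSucc)) := by
    intro i hi
    have := isTheta_rpow_mul (isTheta_poch_div (hb i hi) (hB i.castSucc))
      (isTheta_poch_div (hc i hi) (hC i.castSucc))
    convert this using 3
    simp only [hr, Complex.sub_re, Complex.add_re]
    ring
  have hterm : (fun n : ℕ => multiTerm s a b c (Pi.single j (n + 1))) =Θ[atTop]
      fun n : ℕ => ∏ i, (n : ℝ) ^ E i := by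
    simp only [multiTerm]
    refine Asymptotics.IsTheta.finsetProd fun i _ => ?_
    simp only [partialSum_single, hE]
    rcases lt_trichotomy j i with h | h | h
    · simp only [if_pos h.le, if_pos h, Pi.single_eq_of_ne h.ne', poch_zero]
      refine EventuallyEq.trans_isTheta (Eventually.of_forall fun n => ?_) (hratio i h.le)
      simp only [div_eq_mul_inv, mul_inv, Nat.factorial_zero, Nat.cast_one, inv_one]
      ring
    · subst h
      simp only [if_pos le_rfl, if_neg (lt_irrefl _), if_true, Pi.single_eq_same]
      refine (EventuallyEq.trans_isTheta (Eventually.of_forall fun n => ?_)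
        (isTheta_rpow_mul (isTheta_poch_div he hone) (hratio j le_rfl))).trans_eventuallyEq
        (Eventually.of_forall fun n => ?_)
      · rw [poch_one]
        simp only [div_eq_mul_inv, mul_inv]
        ring
      · dsimp only
        congr 1
        simp only [hr, Complex.one_re]
        ring
    · simp only [if_neg h.not_ge, if_neg h.not_gt, if_neg h.ne', Pi.single_eq_of_ne h.ne,
        poch_zero, Real.rpow_zero]
      simp
  have hinj : Function.Injective fun n : ℕ => (Pi.single j (n + 1) : Fin s → ℕ) := by
    intro m n h
    simpa using Pi.single_injective j h
  have hpow : Summable fun n : ℕ => (n : ℝ) ^ (∑ i, E i) := by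
    refine summable_of_isBigO_nat (hs.comp_injective hinj).norm ?_
    refine Asymptotics.IsBigO.norm_right ?_
    refine (EventuallyEq.isBigO ?_).trans hterm.symm.isBigO
    filter_upwards [eventually_gt_atTop 0] with n hn
    rw [Real.rpow_sum_of_pos (by exact_mod_cast hn)]
  rw [Real.summable_nat_rpow] at hpow
  have hEj : -1 ≤ E j := by
    have := hre j.succ (Fin.castSucc_lt_succ)
    simp only [hE, if_neg (lt_irrefl _), if_true, hr]
    linarith
  have hEi : ∀ i ∈ Finset.univ.erase j, 0 ≤ E i := by
    intro i hi
    simp only [hE]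
    split_ifs with h1 h2
    · have h3 := hre i.succ ((Fin.castSucc_lt_castSucc_iff.2 h1).trans Fin.castSucc_lt_succ)
      have h4 := hre i.castSucc (Fin.castSucc_lt_castSucc_iff.2 h1)
      simp only [hr]
      linarith
    · exact absurd h2.symm (Finset.ne_of_mem_erase hi)
    · exact le_rfl
  rw [← Finset.add_sum_erase _ _ (Finset.mem_univ j)] at hpow
  have := Finset.sum_nonneg hEi
  linarith

theorem le_partialSum {s : ℕ} (k : Fin s → ℕ) {l i : Fin s} (h : l ≤ i) : k l ≤ partialSum k i :=
  Finset.single_le_sum (f := k) (fun _ _ => Nat.zero_le _) (Finset.mem_Iic.2 h)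

theorem re_pos_or_bounded_support {s : ℕ} {a : ℂ} {b c : Fin (s + 1) → ℂ}
    (hB : ∀ j, ∀ m : ℕ, 1 + a - b j ≠ -(m : ℂ)) (hC : ∀ j, ∀ m : ℕ, 1 + a - c j ≠ -(m : ℂ))
    (hs : Summable (multiTerm s a b c)) :
    0 < (1 + a - b (Fin.last s) - c (Fin.last s)).re ∨
      ∀ l : Fin s, ∃ M : ℕ, ∀ k, multiTerm s a b c k ≠ 0 → k l ≤ M := by
  by_contra! hcon
  obtain ⟨hlast, l, hl⟩ := hcon
  have hpoch : ∀ (x : ℂ) (m n : ℕ), x = -(m : ℂ) → poch x n ≠ 0 → n ≤ m := by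
    intro x m n hx h
    by_contra! hlt
    exact h (hx ▸ poch_neg_natCast hlt)
  classical
  -- An index with unbounded `k_l` on the support lies in `J`, so `j = max J ≥ l`. Beyond `j` the
  -- numbers `1+a-b_i-c_i` are nonpositive integers, except possibly the last, which `hlast` covers.
  -- For `i ≥ j`, unboundedness of `k_l` also keeps `b_{i+1}, c_{i+1}` from being such integers.
  set J : Finset (Fin s) := Finset.univ.filter fun i =>
    ∀ m : ℕ, 1 + a - b i.castSucc - c i.castSucc ≠ -(m : ℂ) with hJ
  have hlJ : l ∈ J := by
    rw [hJ, Finset.mem_filter]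
    refine ⟨Finset.mem_univ _, fun m hm => ?_⟩
    obtain ⟨k, hk, hlt⟩ := hl m
    exact absurd (hpoch _ _ _ hm (multiTerm_ne_zero hk l).1) (not_le.2 hlt)
  set j := J.max' ⟨l, hlJ⟩ with hj
  have hlj : l ≤ j := J.le_max' l hlJ
  have hjJ : j ∈ J := J.max'_mem _
  refine not_summable_multiTerm hB hC j (Finset.mem_filter.1 hjJ).2 ?_ ?_ ?_ hs
  · intro i hi m hm
    obtain ⟨k, hk, hlt⟩ := hl m
    have := hpoch _ _ _ hm (multiTerm_ne_zero hk i).2.1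
    exact absurd ((le_partialSum k (hlj.trans hi)).trans this) (not_le.2 hlt)
  · intro i hi m hm
    obtain ⟨k, hk, hlt⟩ := hl m
    have := hpoch _ _ _ hm (multiTerm_ne_zero hk i).2.2
    exact absurd ((le_partialSum k (hlj.trans hi)).trans this) (not_le.2 hlt)
  · intro i hi
    induction i using Fin.lastCases with
    | last => exact hlast
    | cast i =>
      have hiJ : i ∉ J := fun h =>
        absurd (J.le_max' i h) (not_le.2 (Fin.castSucc_lt_castSucc_iff.1 hi))
      simp only [hJ, Finset.mem_filter, Finset.mem_univ, true_and, not_forall, not_not] at hiJ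
      obtain ⟨m, hm⟩ := hiJ
      rw [hm]
      simp

theorem multiDiag_eventually_zero {s : ℕ} {a : ℂ} {b c : Fin (s + 1) → ℂ}
    (h : ∀ l : Fin s, ∃ M : ℕ, ∀ k, multiTerm s a b c k ≠ 0 → k l ≤ M) :
    ∃ K : ℕ, ∀ n, K < n → multiDiag s a b c n = 0 := by
  choose M hM using h
  refine ⟨∑ l, M l, fun n hn => Finset.sum_eq_zero fun k hk => ?_⟩
  by_contra hne
  rw [Finset.Nat.mem_antidiagonalTuple] at hk
  have : ∑ l, k l ≤ ∑ l, M l := Finset.sum_le_sum fun l _ => hM l k hne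
  omega

theorem hasSum_multiDiag {s : ℕ} {a : ℂ} {b c : Fin (s + 1) → ℂ}
    (hs : Summable (multiTerm s a b c)) :
    HasSum (multiDiag s a b c) (∑' k, multiTerm s a b c k) := by
  have h := (Finset.Nat.sigmaAntidiagonalTupleEquivTuple s).hasSum_iff.2 hs.hasSum
  refine h.sigma fun n => ?_
  rw [multiDiag, ← Finset.sum_coe_sort]
  exact hasSum_fintype _

/-! ### The case of `a` a negative integer -/

/-- `(1-m-b)_n` is, up to `(-1)^n`, the product of the last `n` factors of `(b)_m` in reverse order.
-/
theorem poch_reflect (b : ℂ) {m n : ℕ} (h : n ≤ m) :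
    poch b (m - n) * poch (1 - m - b) n = (-1) ^ n * poch b m := by
  induction n with
  | zero => simp [poch_zero]
  | succ n ih =>
    obtain ⟨d, rfl⟩ := Nat.exists_eq_add_of_le h
    have ih := ih (by omega)
    rw [show n + 1 + d - n = d + 1 by omega, poch_succ] at ih
    rw [show n + 1 + d - (n + 1) = d by omega, poch_succ, pow_succ]
    push_cast at ih ⊢
    linear_combination (-1 : ℂ) * ih

theorem poch_div_reflect {b : ℂ} {m n : ℕ} (hb : ∀ i : ℕ, 1 - (m : ℂ) - b ≠ -(i : ℂ))
    (h : n ≤ m) :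
    poch b (m - n) / poch (1 - m - b) (m - n) = (-1) ^ m * (poch b n / poch (1 - m - b) n) := by
  have h1 := poch_reflect b h
  have h2 := poch_reflect b (Nat.sub_le m n)
  rw [Nat.sub_sub_self h] at h2
  have h3 : (-1 : ℂ) ^ m = (-1) ^ (m - n) * (-1) ^ n := by rw [← pow_add, Nat.sub_add_cancel h]
  have h4 : (-1 : ℂ) ^ (m - n) * (-1) ^ (m - n) = 1 := by rw [← mul_pow]; simp
  rw [mul_div_assoc', div_eq_div_iff (poch_ne_zero hb _) (poch_ne_zero hb _), h1, h3, mul_assoc,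
    mul_assoc]
  linear_combination (-(-1) ^ (m - n) * (-1) ^ n) * h2 - (-1) ^ n * poch b m * h4

/-- The signs cancel, leaving a binomial coefficient, even under `n ↦ m - n`, times `(m - 2n)/m`,
which is odd. -/
theorem unitAlpha_neg_natCast {m n : ℕ} (h : n ≤ m) :
    unitAlpha (-(m : ℂ)) n
      = m.factorial * (m - 2 * n) / (m * n.factorial * (m - n).factorial) := by
  have h1 := poch_reflect 1 h
  rw [poch_one, poch_one, show (1 : ℂ) - m - 1 = -m by ring] at h1
  have h2 : poch (-(m : ℂ)) n = (-1) ^ n * m.factorial / (m - n).factorial := by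
    rw [eq_div_iff (natCast_factorial_ne_zero _), mul_comm, h1]
  have h3 : (-1 : ℂ) ^ n * (-1) ^ n = 1 := by rw [← mul_pow]; simp
  rw [unitAlpha, h2, ← neg_sub_neg (2 * (n : ℂ)) m, neg_mul (m : ℂ), div_neg, ← neg_div]
  simp only [div_eq_mul_inv, mul_inv]
  linear_combination (m.factorial * ((m : ℂ) - 2 * n) * (m : ℂ)⁻¹ * (n.factorial : ℂ)⁻¹
    * ((m - n).factorial : ℂ)⁻¹) * h3

theorem unitAlpha_reflect {m n : ℕ} (h : n ≤ m) :
    unitAlpha (-(m : ℂ)) (m - n) = -unitAlpha (-(m : ℂ)) n := by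
  rw [unitAlpha_neg_natCast h, unitAlpha_neg_natCast (Nat.sub_le m n), Nat.sub_sub_self h,
    Nat.cast_sub h]
  simp only [div_eq_mul_inv, mul_inv]
  ring

/-- For `a` a negative integer the well-poised series terminates and is antisymmetric. -/
theorem pFqHasSum_zero_of_neg_natCast {s m : ℕ} {b c : Fin (s + 1) → ℂ}
    (h2 : ∀ i : ℕ, -(m : ℂ) / 2 ≠ -(i : ℂ))
    (hb : ∀ j, ∀ i : ℕ, 1 + -(m : ℂ) - b j ≠ -(i : ℂ))
    (hc : ∀ j, ∀ i : ℕ, 1 + -(m : ℂ) - c j ≠ -(i : ℂ)) :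
    PFqHasSum (vwpUpper s (-(m : ℂ)) b c) (vwpLower s (-(m : ℂ)) b c) (-1) 0 := by
  set f := pFqTerm (vwpUpper s (-(m : ℂ)) b c) (vwpLower s (-(m : ℂ)) b c) (-1) with hf
  have hzero : ∀ n, m < n → f n = 0 := by
    intro n hn
    rw [hf, pFqTerm_vwp _ _ _ _ h2, unitAlpha, poch_neg_natCast hn]
    simp
  have hrefl : ∀ n, n ≤ m → f (m - n) = -f n := by
    intro n hn
    rw [hf, pFqTerm_vwp _ _ _ _ h2, pFqTerm_vwp _ _ _ _ h2, unitAlpha_reflect hn, mul_neg]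
    congr 2
    refine Finset.prod_congr rfl fun j _ => ?_
    have hb' := hb j
    have hc' := hc j
    rw [← sub_eq_add_neg] at hb' hc' ⊢
    -- Reversal costs `(-1)^m` for `b_j` and again for `c_j`, so each pair is invariant.
    rw [← div_mul_div_comm, ← div_mul_div_comm, poch_div_reflect hb' hn, poch_div_reflect hc' hn]
    have : (-1 : ℂ) ^ m * (-1) ^ m = 1 := by rw [← mul_pow]; simp
    linear_combination (poch (b j) n / poch (1 - m - b j) n
      * (poch (c j) n / poch (1 - m - c j) n)) * this
  have hsum : ∑ n ∈ Finset.range (m + 1), f n = 0 := by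
    have h := Finset.sum_range_reflect f (m + 1)
    rw [Finset.sum_congr rfl fun n hn => by
      rw [Nat.add_sub_cancel, hrefl n (Nat.lt_succ_iff.1 (Finset.mem_range.1 hn))],
      Finset.sum_neg_distrib] at h
    exact self_eq_neg.1 h.symm
  refine tendsto_const_nhds.congr' ?_
  filter_upwards [eventually_ge_atTop (m + 1)] with N hN
  rw [← Finset.sum_range_add_sum_Ico _ hN, hsum, zero_add]
  exact (Finset.sum_eq_zero fun n hn => hzero n (Finset.mem_Ico.1 hn).1).symm

/-! ### Passage to the limit -/

theorem gammaFactor_mul_tsum_eq {s : ℕ} {a L : ℂ} {b c : Fin (s + 1) → ℂ}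
    (ha2 : ∀ m : ℕ, a / 2 ≠ -(m : ℂ)) (ha : ∀ m : ℕ, 1 + a ≠ -(m : ℂ))
    (hb : ∀ j, ∀ m : ℕ, 1 + a - b j ≠ -(m : ℂ)) (hc : ∀ j, ∀ m : ℕ, 1 + a - c j ≠ -(m : ℂ))
    (hL : PFqHasSum (vwpUpper s a b c) (vwpLower s a b c) (-1) L)
    (hs : Summable (multiTerm s a b c)) :
    Complex.Gamma (1 + a - b (Fin.last s)) * Complex.Gamma (1 + a - c (Fin.last s))
          / (Complex.Gamma (1 + a) * Complex.Gamma (1 + a - b (Fin.last s) - c (Fin.last s)))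
        * ∑' k : Fin s → ℕ, multiTerm s a b c k = L := by
  obtain ⟨C, hC⟩ := baileyWeight_bounded_variation a
  have lim := tendsto_sum_mul_of_bounded_variation hL (fun N => by simp [baileyWeight])
    (baileyWeight_succ_self a) (tendsto_baileyWeight a) hC
  simp only [sum_pFqTerm_mul_baileyWeight ha2 ha s b c hb hc] at lim
  have hu := hasSum_multiDiag hs
  rw [← hu.tsum_eq]
  set p := b (Fin.last s)
  set q := c (Fin.last s)
  set u := multiDiag s a b c
  change Tendsto (fun N => gammaFactor a p q N
    * ∑ k ∈ Finset.range (N + 1), u k * cesaroNum (1 + a - p - q) (N - k)) atTop (𝓝 L) at lim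
  have hp : ∀ m : ℕ, 1 + a - p ≠ -(m : ℂ) := hb _
  have hq : ∀ m : ℕ, 1 + a - q ≠ -(m : ℂ) := hc _
  rcases re_pos_or_bounded_support hb hc hs with he | hbd
  · have hG : Complex.Gamma (1 + a - p) * Complex.Gamma (1 + a - q)
        / (Complex.Gamma (1 + a) * Complex.Gamma (1 + a - p - q)) ≠ 0 :=
      div_ne_zero (mul_ne_zero (Complex.Gamma_ne_zero hp) (Complex.Gamma_ne_zero hq))
        (mul_ne_zero (Complex.Gamma_ne_zero ha)
          (Complex.Gamma_ne_zero (ne_neg_natCast_of_re_pos he)))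
    -- Dividing by `gammaFactor * cesaroNum`, whose limit is nonzero here, leaves exactly the Cesàro
    -- means.
    rw [tsum_eq_of_tendsto_cesaro he hu.summable (l := L / _) ?_, mul_div_cancel₀ _ hG]
    refine (lim.div (tendsto_gammaFactor_mul hp hq) hG).congr fun N => ?_
    refine mul_div_mul_left _ _ ?_
    exact div_ne_zero (mul_ne_zero (natCast_factorial_ne_zero N) (poch_ne_zero ha N))
      (mul_ne_zero (poch_ne_zero hp N) (poch_ne_zero hq N))
  -- Only the degrees `k ≤ K` contribute, so the limit is taken termwise, even where the Gamma
  -- quotient is 0.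
  · obtain ⟨K, hK⟩ := multiDiag_eventually_zero hbd
    rw [tsum_eq_sum (s := Finset.range (K + 1))
      fun n hn => hK n (by simpa [Nat.lt_succ_iff] using hn), Finset.mul_sum]
    refine tendsto_nhds_unique (Tendsto.congr' ?_ (tendsto_finsetSum (Finset.range (K + 1))
      fun k _ => (tendsto_gammaFactor_mul_shift hp hq k).mul_const (u k))) lim
    filter_upwards [eventually_ge_atTop K] with N hN
    rw [← Finset.sum_range_add_sum_Ico _ (Nat.succ_le_succ hN),
      Finset.sum_eq_zero (s := Finset.Ico _ _) fun n hn => by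
        rw [show u n = 0 from hK n (Finset.mem_Ico.1 hn).1, zero_mul], add_zero, Finset.mul_sum]
    refine Finset.sum_congr rfl fun k _ => ?_
    rw [cesaroNum]
    ring

theorem theorem3p5 (s : ℕ) (a : ℂ) (b c : Fin (s + 1) → ℂ)
    (hlower : AdmissibleLower (vwpLower s a b c))
    (hleft : PFqConverges (vwpUpper s a b c) (vwpLower s a b c) (-1))
    (hright : Summable (multiTerm s a b c)) :
    PFqHasSum (vwpUpper s a b c) (vwpLower s a b c) (-1)
      (Complex.Gamma (1 + a - b (Fin.last s)) * Complex.Gamma (1 + a - c (Fin.last s))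
          / (Complex.Gamma (1 + a) * Complex.Gamma (1 + a - b (Fin.last s) - c (Fin.last s)))
        * ∑' k : Fin s → ℕ, multiTerm s a b c k) := by
  have ha2 : ∀ m : ℕ, a / 2 ≠ -(m : ℂ) := hlower _ (by simp [vwpLower])
  have hmem : ∀ j : Fin (s + 1), (1 + a - b j) ∈ vwpLower s a b c ∧
      (1 + a - c j) ∈ vwpLower s a b c := by
    intro j
    simp only [vwpLower, List.mem_cons, List.mem_flatten, List.mem_ofFn]
    exact ⟨Or.inr ⟨_, ⟨j, rfl⟩, by simp⟩, Or.inr ⟨_, ⟨j, rfl⟩, by simp⟩⟩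
  have hb : ∀ j, ∀ m : ℕ, 1 + a - b j ≠ -(m : ℂ) := fun j => hlower _ (hmem j).1
  have hc : ∀ j, ∀ m : ℕ, 1 + a - c j ≠ -(m : ℂ) := fun j => hlower _ (hmem j).2
  by_cases ha : ∀ m : ℕ, 1 + a ≠ -(m : ℂ)
  · obtain ⟨L, hL⟩ := hleft
    rwa [gammaFactor_mul_tsum_eq ha2 ha hb hc hL hright]
  -- `Complex.Gamma (1 + a)` is 0 at this pole and division by 0 gives 0, matching the convention
  -- `1/Γ = 0`.
  · push Not at ha
    obtain ⟨m, hm⟩ := ha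
    have ha' : a = -((m + 1 : ℕ) : ℂ) := by
      push_cast
      linear_combination hm
    rw [hm, Complex.Gamma_neg_nat_eq_zero, zero_mul, div_zero, zero_mul]
    subst ha'
    exact pFqHasSum_zero_of_neg_natCast ha2 hb hc
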